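/- Let $\omega_1,\omega_3\in\mathbb C$ with $\operatorname{Im}(\omega_3/\omega_1)>0$, let $p,q$ be elliptic functions (meromorphic on $\mathbb C$ with periods $2\omega_1$ and $2\omega_3$), and put $$J=\begin{pmatrix} i&0\\0&-i\end{pmatrix},\qquad Q(x)=\begin{pmatrix}0&-iq(x)\\ ip(x)&0\end{pmatrix}.$$ For $j=1,3$ let $t_j=\omega_j/|\omega_j|$, and fix $x_0\in\mathbb C$ such that no pole of $Q$ lies on the line through $x_0$ and $x_0+2\omega_1$ or on the line through $x_0$ and $x_0+2\omega_3$. For $\zeta\in\mathbb R$ put $Q_j(\zeta)=t_jQ(t_j\zeta+x_0)$, which has period $2|\omega_j|$. A number $E\in\mathbb C$ is called a $4\omega_j$-periodic eigenvalue associated with $Q$ if $t_jE$ is an eigenvalue of the operator $y\mapsto Jy'+Q_jy$ in $L^2([0,4|\omega_j|])^2$ whose domain consists of all absolutely continuous $y$ with $Jy'+Q_jy\in L^2([0,4|\omega_j|])^2$ and $y(4|\omega_j|)=y(0)$; it is called a $2\omega_j$-periodic (respectively $2\omega_j$-semi-periodic) eigenvalue if the same holds with the interval $[0,2|\omega_j|]$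 and the boundary condition $y(2|\omega_j|)=y(0)$ (respectively $y(2|\omega_j|)=-y(0)$). Then, for $j=1,3$, the $4\omega_j$-periodic eigenvalues are exactly the $2\omega_j$-periodic and the $2\omega_j$-semi-periodic ones, and there are constants $C_1,C_3>0$ such that all $4\omega_j$-periodic eigenvalues lie in the strip $$S_j=\{E\in\mathbb C : |\operatorname{Im}(t_jE)|\le C_j\}.$$ The axes $\{E: \operatorname{Im}(t_jE)=0\}$ of $S_1$ and $S_3$ meet at the angle $\theta\in(0,\pi)$ given by $e^{i\theta}=\frac{\omega_3}{\omega_1}\left|\frac{\omega_1}{\omega_3}\right|$; more precisely, rotating the axis of $S_3$ counterclockwise about $0$ by $\theta$ gives the axis of $S_1$. In particular there is $R>0$ such that $S_1\cap S_3$ contains no $E$ with $|E|>R$. -/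

import Mathlib

open Complex MeasureTheory Set
open scoped Matrix

noncomputable section

namespace AKNS

/-- A meromorphic function on `ℂ` with periods `2ω₁` and `2ω₃`. Normal form only fixes the values
of `f` pointwise: `f` is analytic at every point that is not a pole, and has the conventional
value `0` at its poles. -/
structure IsElliptic (ω₁ ω₃ : ℂ) (f : ℂ → ℂ) : Prop where
  meromorphic : MeromorphicNFOn f Set.univ
  periodic₁ : ∀ z, f (z + 2 * ω₁) = f z
  periodic₃ : ∀ z, f (z + 2 * ω₃) = f z

/-- `z` is a pole of the meromorphic function `f`. -/
def IsPole (f : ℂ → ℂ) (z : ℂ) : Prop := meromorphicOrderAt f z < 0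

/-- The matrix `J = diag(i, -i)`. -/
def J : Matrix (Fin 2) (Fin 2) ℂ := !![I, 0; 0, -I]

/-- The potential `Q` with zero diagonal and off-diagonal entries `-iq`, `ip`. -/
def Q (p q : ℂ → ℂ) (x : ℂ) : Matrix (Fin 2) (Fin 2) ℂ :=
  !![0, -I * q x; I * p x, 0]

/-- The unit direction `t = ω / |ω|`. -/
def dir (ω : ℂ) : ℂ := ω / (‖ω‖ : ℂ)

/-- No pole of `Q` lies on the line through `x₀` and `x₀ + 2ω`. -/
def NoPoleOnLine (p q : ℂ → ℂ) (x₀ ω : ℂ) : Prop :=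
  ∀ s : ℝ, ¬ IsPole p (dir ω * s + x₀) ∧ ¬ IsPole q (dir ω * s + x₀)

/-- The potential on the real line, `ζ ↦ t Q(tζ + x₀)` with `t = ω / |ω|`; its period is
`2|ω|`. -/
def lineQ (p q : ℂ → ℂ) (x₀ ω : ℂ) (ζ : ℝ) : Matrix (Fin 2) (Fin 2) ℂ :=
  dir ω • Q p q (dir ω * ζ + x₀)

/-- The differential expression `Ly = Jy' + Vy` on the real line. -/
def L (V : ℝ → Matrix (Fin 2) (Fin 2) ℂ) (y : ℝ → Fin 2 → ℂ) (ζ : ℝ) : Fin 2 → ℂ :=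
  J *ᵥ deriv y ζ + V ζ *ᵥ y ζ

/-- Domain of the realization of `L` in `L²([a,b])²` with boundary condition `y(b) = σ y(a)`. -/
structure InDomain (V : ℝ → Matrix (Fin 2) (Fin 2) ℂ) (a b : ℝ) (σ : ℂ)
    (y : ℝ → Fin 2 → ℂ) : Prop where
  memLp : MemLp y 2 (volume.restrict (Icc a b))
  absolutelyContinuous : AbsolutelyContinuousOnInterval y a b
  boundary : y b = σ • y a
  memLp_L : MemLp (L V y) 2 (volume.restrict (Icc a b))

/-- `μ` is an eigenvalue of the realization of `L` in `L²([a,b])²` with `y(b) = σ y(a)`. -/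
def IsEigenvalue (V : ℝ → Matrix (Fin 2) (Fin 2) ℂ) (a b : ℝ) (σ μ : ℂ) : Prop :=
  ∃ y : ℝ → Fin 2 → ℂ, InDomain V a b σ y ∧
    ¬ (y =ᵐ[volume.restrict (Icc a b)] 0) ∧
    L V y =ᵐ[volume.restrict (Icc a b)] μ • y

/-- `E` is a `2ω`-periodic eigenvalue associated with `Q` (along the line through `x₀`): with
`t = ω/|ω|`, `tE` is an eigenvalue of the periodic problem for `t Q(tζ + x₀)` on `[0, 2|ω|]`. -/
def IsPeriodicEigenvalue (p q : ℂ → ℂ) (x₀ ω E : ℂ) : Prop :=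
  IsEigenvalue (lineQ p q x₀ ω) 0 (2 * ‖ω‖) 1 (dir ω * E)

/-- `E` is a `2ω`-semi-periodic eigenvalue: boundary condition `y(2|ω|) = -y(0)`. -/
def IsSemiPeriodicEigenvalue (p q : ℂ → ℂ) (x₀ ω E : ℂ) : Prop :=
  IsEigenvalue (lineQ p q x₀ ω) 0 (2 * ‖ω‖) (-1) (dir ω * E)

/-- `E` is a `4ω`-periodic eigenvalue: periodic boundary condition on `[0, 4|ω|]`. -/
def IsDoublePeriodicEigenvalue (p q : ℂ → ℂ) (x₀ ω E : ℂ) : Prop :=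
  IsEigenvalue (lineQ p q x₀ ω) 0 (4 * ‖ω‖) 1 (dir ω * E)

/-- The strip `{E : |Im (tE)| ≤ C}`. -/
def strip (t : ℂ) (C : ℝ) : Set ℂ := {E | |(t * E).im| ≤ C}

/-- The axis (middle line) `{E : Im (tE) = 0}` of the strips `{E : |Im (tE)| ≤ C}`. -/
def stripAxis (t : ℂ) : Set ℂ := {E | (t * E).im = 0}

/-- The lines `ℓ` and `ℓ'` through `0` meet at the angle `θ ∈ (0, π)`, measured counterclockwise
from `ℓ` to `ℓ'`. -/
def MeetAtAngle (ℓ ℓ' : Set ℂ) (θ : ℝ) : Prop :=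
  θ ∈ Ioo 0 Real.pi ∧ (fun E : ℂ => exp (θ * I) * E) '' ℓ = ℓ'

end AKNS

end

/-!
Translation by a period acts on the solution space of `Ly = μy` as the monodromy `M`, and an
eigenvalue with boundary multiplier `σ` is a `μ` for which `M - σ` has a kernel; doubling the
interval replaces `M` by `M²`. For `‖σ‖ = 1` the boundary term `|y₀|² - |y₁|²` in Green's formula
for `J d/dx` cancels, which leaves `Im μ ∫ |y|² = ∫ Im ⟨y, Vy⟩` and hence bounds `Im μ` by the size
of `V`. On a line free of poles `V` is continuous and periodic, so it is bounded. Finally, `ω₃ / ω₁`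
is not real, so the two strips have different directions and a bounded intersection.
-/

namespace AKNS

section AbsolutelyContinuous

open AbsolutelyContinuousOnInterval Filter Topology

variable {X Y : Type*} [PseudoMetricSpace X] [PseudoMetricSpace Y] {f : ℝ → X} {a b c d : ℝ}

lemma absolutelyContinuousOnInterval_lipschitz_comp {g : X → Y} {K : NNReal}
    (hg : LipschitzWith K g) (hf : AbsolutelyContinuousOnInterval f a b) :
    AbsolutelyContinuousOnInterval (fun x => g (f x)) a b := by
  have hbound := Tendsto.const_mul (K : ℝ) hf
  rw [mul_zero] at hbound
  refine squeeze_zero (fun E => Finset.sum_nonneg fun _ _ => dist_nonneg) (fun E => ?_) hbound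
  rw [Finset.mul_sum]
  exact Finset.sum_le_sum fun i _ => hg.dist_le_mul _ _

lemma disjoint_uIoc_map_of_monotone {α β : Type*} [LinearOrder α] [LinearOrder β]
    {φ : α → β} (hφ : Monotone φ) {u v w z : α} (h : Disjoint (uIoc u v) (uIoc w z)) :
    Disjoint (uIoc (φ u) (φ v)) (uIoc (φ w) (φ z)) := by
  rw [uIoc, uIoc, Ioc_disjoint_Ioc] at h ⊢
  simpa only [hφ.map_min, hφ.map_max] using hφ h

lemma absolutelyContinuousOnInterval_comp_monotone (hf : AbsolutelyContinuousOnInterval f c d)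
    {φ : ℝ → ℝ} (hφ : AbsolutelyContinuousOnInterval φ a b) (hmono : Monotone φ)
    (hmaps : MapsTo φ (uIcc a b) (uIcc c d)) :
    AbsolutelyContinuousOnInterval (fun x => f (φ x)) a b := by
  have hlength : Tendsto (fun E : ℕ × (ℕ → ℝ × ℝ) => (E.1, fun i => (φ (E.2 i).1, φ (E.2 i).2)))
      (totalLengthFilter ⊓ 𝓟 (disjWithin a b)) totalLengthFilter := tendsto_comap_iff.2 hφ
  have hdisj : MapsTo (fun E : ℕ × (ℕ → ℝ × ℝ) => (E.1, fun i => (φ (E.2 i).1, φ (E.2 i).2)))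
      (disjWithin a b) (disjWithin c d) := fun E hE =>
    ⟨fun i hi => ⟨hmaps (hE.1 i hi).1, hmaps (hE.1 i hi).2⟩,
      fun i hi j hj hij => disjoint_uIoc_map_of_monotone hmono (hE.2 hi hj hij)⟩
  exact hf.comp (tendsto_inf.2 ⟨hlength,
    tendsto_principal.2 (eventually_inf_principal.2 (Eventually.of_forall hdisj))⟩)

lemma absolutelyContinuousOnInterval_comp_add_const
    (hf : AbsolutelyContinuousOnInterval f (a + c) (b + c)) :
    AbsolutelyContinuousOnInterval (fun x => f (x + c)) a b :=
  absolutelyContinuousOnInterval_comp_monotone hf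
    (isometry_add_right c).lipschitz.lipschitzOnWith.absolutelyContinuousOnInterval
    (monotone_id.add_const c) (by rw [mapsTo_iff_image_subset, image_add_const_uIcc])

lemma absolutelyContinuousOnInterval_ite {F : Type*} [NormedAddCommGroup F] {f g : ℝ → F}
    (hab : a ≤ b) (hbc : b ≤ c) (hf : AbsolutelyContinuousOnInterval f a b)
    (hg : AbsolutelyContinuousOnInterval g b c) (hfg : f b = g b) :
    AbsolutelyContinuousOnInterval (fun x => if x ≤ b then f x else g x) a c := by
  have hglue : (fun x => if x ≤ b then f x else g x) =
      fun x => f (min x b) + g (max x b) - (fun _ => g b) x := by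
    ext x
    split_ifs with hx
    · simp [hx]
    · simp [(not_le.1 hx).le, hfg]
  have hmin : AbsolutelyContinuousOnInterval (fun x => f (min x b)) a c :=
    absolutelyContinuousOnInterval_comp_monotone hf
      (LipschitzWith.id.min_const b).lipschitzOnWith.absolutelyContinuousOnInterval
      (monotone_id.min monotone_const) fun x hx => by
        rw [uIcc_of_le (hab.trans hbc)] at hx
        simpa [uIcc_of_le hab] using ⟨hx.1, hab⟩
  have hmax : AbsolutelyContinuousOnInterval (fun x => g (max x b)) a c :=
    absolutelyContinuousOnInterval_comp_monotone hg
      (LipschitzWith.id.max_const b).lipschitzOnWith.absolutelyContinuousOnInterval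
      (monotone_id.max monotone_const) fun x hx => by
        rw [uIcc_of_le (hab.trans hbc)] at hx
        simpa [uIcc_of_le hbc] using ⟨hx.2, hbc⟩
  rw [hglue]
  exact (hmin.fun_add hmax).fun_sub
    (LipschitzWith.const (g b)).lipschitzOnWith.absolutelyContinuousOnInterval

end AbsolutelyContinuous

section Solutions

variable {V : ℝ → Matrix (Fin 2) (Fin 2) ℂ} {a b c T : ℝ} {σ μ : ℂ} {y z : ℝ → Fin 2 → ℂ}

/-- An absolutely continuous solution of `Ly = μy` on `[a, b]`. The equation is imposed only almost
everywhere, as in `IsEigenvalue`, so that no regularity of `V` is needed. -/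
structure IsSolution (V : ℝ → Matrix (Fin 2) (Fin 2) ℂ) (μ : ℂ) (a b : ℝ)
    (y : ℝ → Fin 2 → ℂ) : Prop where
  absolutelyContinuous : AbsolutelyContinuousOnInterval y a b
  L_ae_eq : L V y =ᵐ[volume.restrict (Icc a b)] μ • y

lemma L_add {x : ℝ} (hy : DifferentiableAt ℝ y x) (hz : DifferentiableAt ℝ z x) :
    L V (y + z) x = L V y x + L V z x := by
  simp only [L, deriv_add hy hz, Pi.add_apply, Matrix.mulVec_add]
  abel

lemma L_const_smul {x : ℝ} (hy : DifferentiableAt ℝ y x) (k : ℂ) :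
    L V (k • y) x = k • L V y x := by
  simp only [L, deriv_const_smul k hy, Pi.smul_apply, Matrix.mulVec_smul, smul_add]

lemma L_congr {x : ℝ} (h : y =ᶠ[nhds x] z) : L V y x = L V z x := by
  simp only [L, h.deriv_eq, h.eq_of_nhds]

lemma L_comp_add_const (hV : Function.Periodic V T) (x : ℝ) :
    L V (fun s => y (s + T)) x = L V y (x + T) := by
  simp only [L, deriv_comp_add_const, hV x]

namespace IsSolution

lemma continuousOn (hy : IsSolution V μ a b y) : ContinuousOn y (Icc a b) :=
  hy.absolutelyContinuous.continuousOn.mono Icc_subset_uIcc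

lemma ae_differentiableAt (hy : IsSolution V μ a b y) :
    ∀ᵐ x ∂volume.restrict (Icc a b), DifferentiableAt ℝ y x := by
  rw [ae_restrict_iff' measurableSet_Icc]
  filter_upwards [hy.absolutelyContinuous.boundedVariationOn.ae_differentiableAt_of_mem_uIcc]
    with x hx hmem using hx (Icc_subset_uIcc hmem)

lemma add (hy : IsSolution V μ a b y) (hz : IsSolution V μ a b z) :
    IsSolution V μ a b (y + z) where
  absolutelyContinuous := hy.absolutelyContinuous.add hz.absolutelyContinuous
  L_ae_eq := by
    filter_upwards [hy.L_ae_eq, hz.L_ae_eq, hy.ae_differentiableAt, hz.ae_differentiableAt]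
      with x hLy hLz hdy hdz
    rw [L_add hdy hdz, hLy, hLz, smul_add, Pi.add_apply]

lemma const_smul (hy : IsSolution V μ a b y) (k : ℂ) : IsSolution V μ a b (k • y) where
  absolutelyContinuous := hy.absolutelyContinuous.const_smul k
  L_ae_eq := by
    filter_upwards [hy.L_ae_eq, hy.ae_differentiableAt] with x hLy hdy
    rw [L_const_smul hdy, hLy]
    exact smul_comm k μ (y x)

lemma mono {a' b' : ℝ} (hy : IsSolution V μ a b y) (ha : a ≤ a') (hab : a' ≤ b') (hb : b' ≤ b) :
    IsSolution V μ a' b' y where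
  absolutelyContinuous := hy.absolutelyContinuous.mono <| by
    rw [uIcc_of_le hab, uIcc_of_le (ha.trans (hab.trans hb))]
    exact Icc_subset_Icc ha hb
  L_ae_eq := ae_restrict_of_ae_restrict_of_subset (Icc_subset_Icc ha hb) hy.L_ae_eq

lemma comp_add_period (hV : Function.Periodic V T) (hy : IsSolution V μ (a + T) (b + T) y) :
    IsSolution V μ a b (fun x => y (x + T)) where
  absolutelyContinuous := absolutelyContinuousOnInterval_comp_add_const hy.absolutelyContinuous
  L_ae_eq := by
    have hshift := (measurePreserving_add_right volume T).restrict_preimage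
      (measurableSet_Icc (a := a + T) (b := b + T))
    rw [preimage_add_const_Icc, add_sub_cancel_right, add_sub_cancel_right] at hshift
    filter_upwards [hshift.quasiMeasurePreserving.ae hy.L_ae_eq] with x hx
    rw [L_comp_add_const hV, hx, Pi.smul_apply, Pi.smul_apply]

lemma glue (hab : a ≤ b) (hbc : b ≤ c) (hy : IsSolution V μ a b y) (hz : IsSolution V μ b c z)
    (hyz : y b = z b) : IsSolution V μ a c (fun x => if x ≤ b then y x else z x) where
  absolutelyContinuous := absolutelyContinuousOnInterval_ite hab hbc hy.absolutelyContinuous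
    hz.absolutelyContinuous hyz
  L_ae_eq := by
    have hLy := (ae_restrict_iff' measurableSet_Icc).1 hy.L_ae_eq
    have hLz := (ae_restrict_iff' measurableSet_Icc).1 hz.L_ae_eq
    refine (ae_restrict_iff' measurableSet_Icc).2 ?_
    filter_upwards [hLy, hLz, Measure.ae_ne volume b] with x hxy hxz hne hx
    rcases hne.lt_or_gt with hlt | hgt
    · have heq : (fun x => if x ≤ b then y x else z x) =ᶠ[nhds x] y :=
        Filter.eventuallyEq_of_mem (Iio_mem_nhds hlt) fun s hs => if_pos (le_of_lt hs)
      rw [L_congr heq, hxy ⟨hx.1, hlt.le⟩, Pi.smul_apply, Pi.smul_apply, heq.eq_of_nhds]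
    · have heq : (fun x => if x ≤ b then y x else z x) =ᶠ[nhds x] z :=
        Filter.eventuallyEq_of_mem (Ioi_mem_nhds hgt) fun s hs => if_neg (not_le_of_gt hs)
      rw [L_congr heq, hxz ⟨hgt.le, hx.2⟩, Pi.smul_apply, Pi.smul_apply, heq.eq_of_nhds]

lemma memLp (hy : IsSolution V μ a b y) : MemLp y 2 (volume.restrict (Icc a b)) := by
  obtain ⟨C, hC⟩ := isCompact_Icc.exists_bound_of_continuousOn hy.continuousOn
  exact MemLp.of_bound (hy.continuousOn.aestronglyMeasurable measurableSet_Icc) C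
    ((ae_restrict_mem measurableSet_Icc).mono hC)

end IsSolution

lemma isEigenvalue_iff_exists_isSolution (hab : a < b) :
    IsEigenvalue V a b σ μ ↔
      ∃ y, IsSolution V μ a b y ∧ (∃ x ∈ Icc a b, y x ≠ 0) ∧ y b = σ • y a := by
  constructor
  · rintro ⟨y, hdom, hne, hL⟩
    refine ⟨y, ⟨hdom.absolutelyContinuous, hL⟩, ?_, hdom.boundary⟩
    contrapose! hne
    filter_upwards [ae_restrict_mem measurableSet_Icc] with x hx using hne x hx
  · rintro ⟨y, hy, ⟨x, hx, hne⟩, hbd⟩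
    refine ⟨y, ⟨hy.memLp, hy.absolutelyContinuous, hbd,
      (hy.memLp.const_smul μ).ae_eq hy.L_ae_eq.symm⟩, fun hzero => hne ?_, hy.L_ae_eq⟩
    exact Measure.eqOn_Icc_of_ae_eq volume hab.ne hzero hy.continuousOn continuousOn_const hx

end Solutions

section PeriodDoubling

variable {V : ℝ → Matrix (Fin 2) (Fin 2) ℂ} {a T : ℝ} {σ μ : ℂ}

lemma IsEigenvalue.double (hV : Function.Periodic V T) (hT : 0 < T)
    (h : IsEigenvalue V a (a + T) σ μ) : IsEigenvalue V a (a + T + T) (σ ^ 2) μ := by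
  rw [isEigenvalue_iff_exists_isSolution (by linarith)] at h ⊢
  obtain ⟨y, hy, ⟨x, hx, hne⟩, hbd⟩ := h
  have hshift : IsSolution V μ (a + T) (a + T + T) (σ • fun x => y (x + -T)) := by
    refine IsSolution.const_smul (IsSolution.comp_add_period hV.neg ?_) σ
    rwa [add_neg_cancel_right, add_neg_cancel_right]
  refine ⟨_, hy.glue (by linarith) (by linarith) hshift ?_,
    ⟨x, ⟨hx.1, by linarith [hx.2]⟩, ?_⟩, ?_⟩
  · rw [Pi.smul_apply, add_neg_cancel_right, hbd]
  · rwa [if_pos hx.2]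
  · rw [if_neg (by linarith), if_pos (by linarith), Pi.smul_apply, add_neg_cancel_right, hbd,
      smul_smul, sq]

/-- The factorization `M² - σ² = (M - σ)(M + σ)` of the monodromy `M`: if `y(· + T) + σy` vanishes,
then `y` itself has multiplier `-σ`, and otherwise this function has multiplier `σ`. -/
lemma IsEigenvalue.of_double (hV : Function.Periodic V T) (hT : 0 < T)
    (h : IsEigenvalue V a (a + T + T) (σ ^ 2) μ) :
    IsEigenvalue V a (a + T) σ μ ∨ IsEigenvalue V a (a + T) (-σ) μ := by
  rw [isEigenvalue_iff_exists_isSolution (by linarith)] at h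
  simp only [isEigenvalue_iff_exists_isSolution (lt_add_of_pos_right a hT)]
  obtain ⟨y, hy, ⟨x, hx, hne⟩, hbd⟩ := h
  have hleft : IsSolution V μ a (a + T) y := hy.mono le_rfl (by linarith) (by linarith)
  have hright : IsSolution V μ a (a + T) fun x => y (x + T) :=
    (hy.mono (by linarith) (by linarith) le_rfl).comp_add_period hV
  by_cases hw : ∃ s ∈ Icc a (a + T), y (s + T) + σ • y s ≠ 0
  · refine Or.inl ⟨_, hright.add (hleft.const_smul σ), hw, ?_⟩
    simp only [Pi.add_apply, Pi.smul_apply, hbd]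
    module
  · have hanti : ∀ s ∈ Icc a (a + T), y (s + T) = -σ • y s := fun s hs => by
      rw [neg_smul, eq_neg_iff_add_eq_zero]
      exact not_not.1 fun hs' => hw ⟨s, hs, hs'⟩
    refine Or.inr ⟨y, hleft, ?_, hanti a (left_mem_Icc.2 (by linarith))⟩
    rcases le_total x (a + T) with hxT | hTx
    · exact ⟨x, ⟨hx.1, hxT⟩, hne⟩
    · have hmem : x - T ∈ Icc a (a + T) := ⟨by linarith, by linarith [hx.2]⟩
      refine ⟨x - T, hmem, fun hzero => hne ?_⟩
      rw [← sub_add_cancel x T, hanti _ hmem, hzero, smul_zero]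

lemma isEigenvalue_double_iff (hV : Function.Periodic V T) (hT : 0 < T) :
    IsEigenvalue V a (a + T + T) (σ ^ 2) μ ↔
      IsEigenvalue V a (a + T) σ μ ∨ IsEigenvalue V a (a + T) (-σ) μ := by
  refine ⟨IsEigenvalue.of_double hV hT, ?_⟩
  rintro (h | h)
  · exact h.double hV hT
  · rw [← neg_sq]
    exact h.double hV hT

end PeriodDoubling

section ImaginaryPart

variable {V : ℝ → Matrix (Fin 2) (Fin 2) ℂ} {a b K x : ℝ} {σ μ : ℂ} {y : ℝ → Fin 2 → ℂ}

/-- The indefinite form whose boundary values are the boundary term of Green's formula for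
`J d/dx`. -/
noncomputable def kreinForm (v : Fin 2 → ℂ) : ℝ := ‖v 0‖ ^ 2 - ‖v 1‖ ^ 2

lemma kreinForm_smul (c : ℂ) (v : Fin 2 → ℂ) : kreinForm (c • v) = ‖c‖ ^ 2 * kreinForm v := by
  simp only [kreinForm, Pi.smul_apply, smul_eq_mul, norm_mul]
  ring

lemma absolutelyContinuousOnInterval_kreinForm_comp (hy : AbsolutelyContinuousOnInterval y a b) :
    AbsolutelyContinuousOnInterval (fun x => kreinForm (y x)) a b := by
  have hnorm (i : Fin 2) : AbsolutelyContinuousOnInterval (fun x => ‖y x i‖) a b :=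
    absolutelyContinuousOnInterval_lipschitz_comp
      (g := fun v : Fin 2 → ℂ => ‖v i‖) (lipschitzWith_one_norm.comp (LipschitzWith.eval i)) hy
  simp only [kreinForm, sq]
  exact ((hnorm 0).fun_mul (hnorm 0)).fun_sub ((hnorm 1).fun_mul (hnorm 1))

lemma hasDerivAt_kreinForm_comp {y' : Fin 2 → ℂ} (hy : HasDerivAt y y' x) :
    HasDerivAt (fun x => kreinForm (y x)) (2 * (star (y x) ⬝ᵥ (J *ᵥ y')).im) x := by
  have h := hasDerivAt_pi.1 hy
  convert! (h 0).norm_sq.sub (h 1).norm_sq using 1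
  simp [J, Matrix.mulVec, dotProduct, Fin.sum_univ_two, Complex.inner]
  ring

lemma star_dotProduct_smul_im (μ : ℂ) (v : Fin 2 → ℂ) :
    (star v ⬝ᵥ (μ • v)).im = μ.im * (‖v 0‖ ^ 2 + ‖v 1‖ ^ 2) := by
  simp [dotProduct, Fin.sum_univ_two, ← normSq_eq_norm_sq, normSq_apply]
  ring

lemma deriv_kreinForm_comp (hy : DifferentiableAt ℝ y x) (hL : L V y x = μ • y x) :
    deriv (fun x => kreinForm (y x)) x =
      2 * (μ.im * (‖y x 0‖ ^ 2 + ‖y x 1‖ ^ 2) - (star (y x) ⬝ᵥ (V x *ᵥ y x)).im) := by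
  rw [(hasDerivAt_kreinForm_comp hy.hasDerivAt).deriv, eq_sub_of_add_eq hL, dotProduct_sub,
    sub_im, star_dotProduct_smul_im]

lemma IsSolution.integral_normSq_pos (hab : a < b) (hy : IsSolution V μ a b y)
    (hne : ∃ x ∈ Icc a b, y x ≠ 0) : 0 < ∫ x in a..b, (‖y x 0‖ ^ 2 + ‖y x 1‖ ^ 2) := by
  obtain ⟨c, hc, hyc⟩ := hne
  obtain ⟨i, hi⟩ := Function.ne_iff.1 hyc
  have hcont := continuousOn_pi.1 hy.continuousOn
  refine intervalIntegral.integral_pos hab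
    (((hcont 0).norm.pow 2).add ((hcont 1).norm.pow 2)) (fun x _ => by positivity) ⟨c, hc, ?_⟩
  have hpos : 0 < ‖y c i‖ ^ 2 := by
    have := norm_pos_iff.2 hi
    positivity
  calc 0 < ‖y c i‖ ^ 2 := hpos
    _ ≤ ∑ j, ‖y c j‖ ^ 2 := Finset.single_le_sum (f := fun j => ‖y c j‖ ^ 2)
        (fun j _ => by positivity) (Finset.mem_univ i)
    _ = ‖y c 0‖ ^ 2 + ‖y c 1‖ ^ 2 := Fin.sum_univ_two _

lemma IsEigenvalue.abs_im_le (hab : a < b) (hσ : ‖σ‖ = 1)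
    (hV : ∀ x ∈ Icc a b, ∀ v : Fin 2 → ℂ,
      |(star v ⬝ᵥ (V x *ᵥ v)).im| ≤ K * (‖v 0‖ ^ 2 + ‖v 1‖ ^ 2))
    (h : IsEigenvalue V a b σ μ) : |μ.im| ≤ K := by
  rw [isEigenvalue_iff_exists_isSolution hab] at h
  obtain ⟨y, hy, hne, hbd⟩ := h
  set N : ℝ → ℝ := fun x => ‖y x 0‖ ^ 2 + ‖y x 1‖ ^ 2
  have hNint : IntervalIntegrable N volume a b := by
    have hcont := continuousOn_pi.1 hy.continuousOn
    exact (((hcont 0).norm.pow 2).add ((hcont 1).norm.pow 2)).intervalIntegrable_of_Icc hab.le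
  have hac := absolutelyContinuousOnInterval_kreinForm_comp hy.absolutelyContinuous
  have hgreen : ∫ x in a..b, deriv (fun x => kreinForm (y x)) x = 0 := by
    rw [hac.integral_deriv_eq_sub, hbd, kreinForm_smul, hσ]
    ring
  have hpointwise : ∀ᵐ x, x ∈ Ioc a b →
      ‖2 * μ.im * N x - deriv (fun x => kreinForm (y x)) x‖ ≤ 2 * K * N x := by
    filter_upwards [(ae_restrict_iff' measurableSet_Icc).1 hy.L_ae_eq,
      (ae_restrict_iff' measurableSet_Icc).1 hy.ae_differentiableAt] with x hL hd hx
    have hx' := Ioc_subset_Icc_self hx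
    rw [deriv_kreinForm_comp (hd hx') (hL hx'), mul_assoc, ← mul_sub, sub_sub_cancel, norm_mul,
      Real.norm_two, mul_assoc]
    exact mul_le_mul_of_nonneg_left (hV x hx' (y x)) two_pos.le
  have hintegrated : 2 * |μ.im| * ∫ x in a..b, N x ≤ 2 * K * ∫ x in a..b, N x := by
    calc 2 * |μ.im| * ∫ x in a..b, N x
        = ‖∫ x in a..b, (2 * μ.im * N x - deriv (fun x => kreinForm (y x)) x)‖ := by
          rw [intervalIntegral.integral_sub (hNint.const_mul _) hac.intervalIntegrable_deriv,
            hgreen, sub_zero, intervalIntegral.integral_const_mul, norm_mul, norm_mul,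
            Real.norm_two, Real.norm_eq_abs, Real.norm_eq_abs,
            abs_of_pos (hy.integral_normSq_pos hab hne)]
      _ ≤ ∫ x in a..b, 2 * K * N x :=
          intervalIntegral.norm_integral_le_of_norm_le hab.le hpointwise (hNint.const_mul _)
      _ = 2 * K * ∫ x in a..b, N x := intervalIntegral.integral_const_mul _ _
  have := le_of_mul_le_mul_right hintegrated (hy.integral_normSq_pos hab hne)
  linarith

lemma abs_im_star_dotProduct_mulVec_le {A : Matrix (Fin 2) (Fin 2) ℂ} (h₀₀ : A 0 0 = 0)
    (h₁₁ : A 1 1 = 0) (h₀₁ : ‖A 0 1‖ ≤ K) (h₁₀ : ‖A 1 0‖ ≤ K) (v : Fin 2 → ℂ) :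
    |(star v ⬝ᵥ (A *ᵥ v)).im| ≤ K * (‖v 0‖ ^ 2 + ‖v 1‖ ^ 2) := by
  have hK : 0 ≤ K := (norm_nonneg _).trans h₀₁
  calc |(star v ⬝ᵥ (A *ᵥ v)).im|
      ≤ ‖star v ⬝ᵥ (A *ᵥ v)‖ := abs_im_le_norm _
    _ = ‖star (v 0) * (A 0 1 * v 1) + star (v 1) * (A 1 0 * v 0)‖ := by
        simp [dotProduct, Matrix.mulVec, Fin.sum_univ_two, h₀₀, h₁₁]
    _ ≤ ‖v 0‖ * (K * ‖v 1‖) + ‖v 1‖ * (K * ‖v 0‖) := by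
        refine (norm_add_le _ _).trans ?_
        simp only [norm_mul, norm_star]
        gcongr
    _ = K * (2 * ‖v 0‖ * ‖v 1‖) := by ring
    _ ≤ K * (‖v 0‖ ^ 2 + ‖v 1‖ ^ 2) := by
        gcongr
        exact two_mul_le_add_sq _ _

end ImaginaryPart

section Line

variable {ω₁ ω₃ ω x₀ : ℂ} {p q f : ℂ → ℂ}

lemma norm_dir (hω : ω ≠ 0) : ‖dir ω‖ = 1 := by
  simp [dir, norm_ne_zero_iff.2 hω]

lemma dir_mul_norm (ω : ℂ) : dir ω * (‖ω‖ : ℂ) = ω :=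
  div_mul_cancel_of_imp fun h => by simpa using h

/-- `f`, restricted to the line through `x₀` and `x₀ + 2ω`, is bounded and has period `2ω`: all that
the spectral problems along that line require of the entries `p`, `q` of the potential. -/
structure IsPeriodicBoundedOnLine (f : ℂ → ℂ) (x₀ ω : ℂ) : Prop where
  periodic : Function.Periodic (fun ζ : ℝ => f (dir ω * ζ + x₀)) (2 * ‖ω‖)
  bounded : ∃ K : ℝ, ∀ ζ : ℝ, ‖f (dir ω * ζ + x₀)‖ ≤ K

lemma IsElliptic.analyticAt (hf : IsElliptic ω₁ ω₃ f) {z : ℂ} (hz : ¬ IsPole f z) :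
    AnalyticAt ℂ f z :=
  (hf.meromorphic (mem_univ z)).meromorphicOrderAt_nonneg_iff_analyticAt.1 (not_lt.1 hz)

lemma IsElliptic.continuous_line (hf : IsElliptic ω₁ ω₃ f)
    (h : ∀ ζ : ℝ, ¬ IsPole f (dir ω * ζ + x₀)) :
    Continuous fun ζ : ℝ => f (dir ω * ζ + x₀) :=
  continuous_iff_continuousAt.2 fun ζ =>
    (hf.analyticAt (h ζ)).continuousAt.comp (f := fun ζ : ℝ => dir ω * ζ + x₀)
      (Continuous.continuousAt (by fun_prop))

lemma IsElliptic.periodic_of_mem (hf : IsElliptic ω₁ ω₃ f) (hω : ω ∈ ({ω₁, ω₃} : Set ℂ)) :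
    Function.Periodic f (2 * ω) := by
  rcases hω with rfl | rfl
  · exact hf.periodic₁
  · exact hf.periodic₃

lemma periodic_line (hf : Function.Periodic f (2 * ω)) :
    Function.Periodic (fun ζ : ℝ => f (dir ω * ζ + x₀)) (2 * ‖ω‖) := fun ζ => by
  have hshift : dir ω * ((ζ + 2 * ‖ω‖ : ℝ) : ℂ) + x₀ = dir ω * ζ + x₀ + 2 * ω := by
    push_cast
    linear_combination 2 * dir_mul_norm ω
  simp only [hshift, hf _]

lemma IsElliptic.isPeriodicBoundedOnLine (hf : IsElliptic ω₁ ω₃ f)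
    (hω : ω ∈ ({ω₁, ω₃} : Set ℂ)) (h : ∀ ζ : ℝ, ¬ IsPole f (dir ω * ζ + x₀)) :
    IsPeriodicBoundedOnLine f x₀ ω := by
  have hper := periodic_line (x₀ := x₀) (hf.periodic_of_mem hω)
  refine ⟨hper, ?_⟩
  rcases eq_or_ne ω 0 with rfl | hω0
  · exact ⟨‖f x₀‖, fun ζ => by simp [dir]⟩
  · obtain ⟨K, hK⟩ := (hper.isBounded_of_continuous (by positivity)
      (hf.continuous_line h)).exists_norm_le
    exact ⟨K, fun ζ => hK _ (mem_range_self ζ)⟩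

namespace IsPeriodicBoundedOnLine

lemma periodic_lineQ (hp : IsPeriodicBoundedOnLine p x₀ ω) (hq : IsPeriodicBoundedOnLine q x₀ ω) :
    Function.Periodic (lineQ p q x₀ ω) (2 * ‖ω‖) := fun ζ => by
  simp only [lineQ, Q, hp.periodic ζ, hq.periodic ζ]

lemma isDoublePeriodicEigenvalue_iff (hp : IsPeriodicBoundedOnLine p x₀ ω)
    (hq : IsPeriodicBoundedOnLine q x₀ ω) (hω : ω ≠ 0) (E : ℂ) :
    IsDoublePeriodicEigenvalue p q x₀ ω E ↔
      IsPeriodicEigenvalue p q x₀ ω E ∨ IsSemiPeriodicEigenvalue p q x₀ ω E := by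
  have h := isEigenvalue_double_iff (a := 0) (σ := 1) (μ := dir ω * E) (hp.periodic_lineQ hq)
    (by positivity)
  rwa [zero_add, one_pow, ← two_mul, ← mul_assoc, show (2 : ℝ) * 2 = 4 by norm_num] at h

lemma exists_forall_mem_strip (hp : IsPeriodicBoundedOnLine p x₀ ω)
    (hq : IsPeriodicBoundedOnLine q x₀ ω) (hω : ω ≠ 0) :
    ∃ C : ℝ, 0 < C ∧ ∀ E : ℂ, IsDoublePeriodicEigenvalue p q x₀ ω E → E ∈ strip (dir ω) C := by
  obtain ⟨A, hA⟩ := hp.bounded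
  obtain ⟨B, hB⟩ := hq.bounded
  refine ⟨max (max A B) 1, by positivity, fun E hE => ?_⟩
  refine IsEigenvalue.abs_im_le (by positivity) norm_one (fun ζ _ => ?_) hE
  refine abs_im_star_dotProduct_mulVec_le (by simp [lineQ, Q]) (by simp [lineQ, Q]) ?_ ?_
  · simpa [lineQ, Q, norm_dir hω] using Or.inl (Or.inr (hB ζ))
  · simpa [lineQ, Q, norm_dir hω] using Or.inl (Or.inl (hA ζ))

end IsPeriodicBoundedOnLine

end Line

section Strips

lemma arg_mem_Ioo_of_im_pos {z : ℂ} (hz : 0 < z.im) : arg z ∈ Ioo 0 Real.pi :=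
  ⟨(arg_nonneg_iff.2 hz.le).lt_of_ne fun h => hz.ne' (arg_eq_zero_iff.1 h.symm).2,
    arg_lt_pi_iff.2 (Or.inr hz.ne')⟩

lemma exp_arg_mul_I {z : ℂ} (hz : z ≠ 0) : exp (arg z * I) = dir z := by
  rw [dir, eq_div_iff (by simpa using hz), mul_comm, norm_mul_exp_arg_mul_I]

lemma dir_div (z w : ℂ) : dir (z / w) = dir z / dir w := by
  rw [dir, dir, dir, norm_div, ofReal_div, div_div_div_comm]

lemma meetAtAngle_stripAxis {θ : ℝ} (hθ : θ ∈ Ioo 0 Real.pi) (t : ℂ) :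
    MeetAtAngle (stripAxis (exp (θ * I) * t)) (stripAxis t) θ := by
  refine ⟨hθ, ?_⟩
  ext E
  constructor
  · rintro ⟨F, hF, rfl⟩
    rwa [stripAxis, mem_ofPred_eq, ← mul_assoc, mul_comm t]
  · intro hE
    refine ⟨(exp (θ * I))⁻¹ * E, ?_, mul_inv_cancel_left₀ (exp_ne_zero _) E⟩
    rwa [stripAxis, mem_ofPred_eq, mul_right_comm, mul_inv_cancel_left₀ (exp_ne_zero _), mul_comm]

lemma norm_le_of_abs_im_le_of_abs_im_rotation_le {θ C₁ C₃ : ℝ} (hθ : θ ∈ Ioo 0 Real.pi) {w : ℂ}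
    (h₁ : |w.im| ≤ C₁) (h₃ : |(exp (θ * I) * w).im| ≤ C₃) :
    ‖w‖ ≤ (C₁ + C₃) / Real.sin θ + C₁ := by
  have hsin := Real.sin_pos_of_mem_Ioo hθ
  rw [mul_im, exp_ofReal_mul_I_re, exp_ofReal_mul_I_im] at h₃
  have hre : |w.re| ≤ (C₁ + C₃) / Real.sin θ := by
    rw [le_div_iff₀ hsin]
    calc |w.re| * Real.sin θ
        = |(Real.cos θ * w.im + Real.sin θ * w.re) - Real.cos θ * w.im| := by
          rw [add_sub_cancel_left, abs_mul, abs_of_pos hsin, mul_comm]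
      _ ≤ |Real.cos θ * w.im + Real.sin θ * w.re| + |Real.cos θ * w.im| := abs_sub _ _
      _ ≤ C₃ + 1 * C₁ := by
          rw [abs_mul (Real.cos θ)]
          gcongr
          exact Real.abs_cos_le_one θ
      _ = C₁ + C₃ := by ring
  exact (norm_le_abs_re_add_abs_im w).trans (add_le_add hre h₁)

lemma norm_le_of_mem_strip_inter {t E : ℂ} (ht : ‖t‖ = 1) {θ C₁ C₃ : ℝ}
    (hθ : θ ∈ Ioo 0 Real.pi) (hE : E ∈ strip t C₁ ∩ strip (exp (θ * I) * t) C₃) :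
    ‖E‖ ≤ (C₁ + C₃) / Real.sin θ + C₁ := by
  have h := norm_le_of_abs_im_le_of_abs_im_rotation_le hθ hE.1
    (by simpa [strip, mul_assoc] using hE.2)
  rwa [norm_mul, ht, one_mul] at h

end Strips

end AKNS

theorem theoremt5p3_general (ω₁ ω₃ : ℂ) (hω : 0 < (ω₃ / ω₁).im) (p q : ℂ → ℂ) (x₀ : ℂ)
    (hp : ∀ ω ∈ ({ω₁, ω₃} : Set ℂ), AKNS.IsPeriodicBoundedOnLine p x₀ ω)
    (hq : ∀ ω ∈ ({ω₁, ω₃} : Set ℂ), AKNS.IsPeriodicBoundedOnLine q x₀ ω) :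
    (∀ ω ∈ ({ω₁, ω₃} : Set ℂ), ∀ E : ℂ,
      AKNS.IsDoublePeriodicEigenvalue p q x₀ ω E ↔
        AKNS.IsPeriodicEigenvalue p q x₀ ω E ∨ AKNS.IsSemiPeriodicEigenvalue p q x₀ ω E) ∧
    ∃ C₁ C₃ : ℝ, 0 < C₁ ∧ 0 < C₃ ∧
      (∀ E : ℂ, AKNS.IsDoublePeriodicEigenvalue p q x₀ ω₁ E → E ∈ AKNS.strip (AKNS.dir ω₁) C₁) ∧
      (∀ E : ℂ, AKNS.IsDoublePeriodicEigenvalue p q x₀ ω₃ E → E ∈ AKNS.strip (AKNS.dir ω₃) C₃) ∧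
      (∃ θ : ℝ, θ ∈ Set.Ioo 0 Real.pi ∧
        Complex.exp (θ * Complex.I) = ω₃ / ω₁ * (‖ω₁ / ω₃‖ : ℂ) ∧
        AKNS.MeetAtAngle (AKNS.stripAxis (AKNS.dir ω₃)) (AKNS.stripAxis (AKNS.dir ω₁)) θ) ∧
      ∃ R : ℝ, 0 < R ∧ ∀ E : ℂ, R < ‖E‖ →
        E ∉ AKNS.strip (AKNS.dir ω₁) C₁ ∩ AKNS.strip (AKNS.dir ω₃) C₃ := by
  have hz : ω₃ / ω₁ ≠ 0 := fun h => by simp [h] at hω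
  obtain ⟨hω₃, hω₁⟩ := div_ne_zero_iff.1 hz
  have hne : ∀ ω ∈ ({ω₁, ω₃} : Set ℂ), ω ≠ 0 := by simp [hω₁, hω₃]
  obtain ⟨h₁, h₃⟩ : ω₁ ∈ ({ω₁, ω₃} : Set ℂ) ∧ ω₃ ∈ ({ω₁, ω₃} : Set ℂ) := by simp
  obtain ⟨C₁, hC₁, hstrip₁⟩ := (hp ω₁ h₁).exists_forall_mem_strip (hq ω₁ h₁) hω₁
  obtain ⟨C₃, hC₃, hstrip₃⟩ := (hp ω₃ h₃).exists_forall_mem_strip (hq ω₃ h₃) hω₃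
  have hθ := AKNS.arg_mem_Ioo_of_im_pos hω
  have hexp := AKNS.exp_arg_mul_I hz
  have hdir : AKNS.dir ω₃ = exp (arg (ω₃ / ω₁) * I) * AKNS.dir ω₁ := by
    rw [hexp, AKNS.dir_div, div_mul_cancel₀ _ (norm_ne_zero_iff.1 (by simp [AKNS.norm_dir hω₁]))]
  refine ⟨fun ω hmem E => (hp ω hmem).isDoublePeriodicEigenvalue_iff (hq ω hmem) (hne ω hmem) E,
    C₁, C₃, hC₁, hC₃, hstrip₁, hstrip₃, ⟨arg (ω₃ / ω₁), hθ, ?_, ?_⟩,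
    (C₁ + C₃) / Real.sin (arg (ω₃ / ω₁)) + C₁, ?_, fun E hE hmem => hE.not_ge ?_⟩
  · rw [hexp, AKNS.dir, div_eq_mul_inv, ← ofReal_inv, ← norm_inv, inv_div]
  · exact hdir ▸ AKNS.meetAtAngle_stripAxis hθ (AKNS.dir ω₁)
  · have := Real.sin_pos_of_mem_Ioo hθ
    positivity
  · exact AKNS.norm_le_of_mem_strip_inter (AKNS.norm_dir hω₁) hθ (hdir ▸ hmem)

theorem theoremt5p3 (ω₁ ω₃ : ℂ) (hω : 0 < (ω₃ / ω₁).im)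
    (p q : ℂ → ℂ) (hp : AKNS.IsElliptic ω₁ ω₃ p) (hq : AKNS.IsElliptic ω₁ ω₃ q)
    (x₀ : ℂ) (h₁ : AKNS.NoPoleOnLine p q x₀ ω₁) (h₃ : AKNS.NoPoleOnLine p q x₀ ω₃) :
    (∀ ω ∈ ({ω₁, ω₃} : Set ℂ), ∀ E : ℂ,
      AKNS.IsDoublePeriodicEigenvalue p q x₀ ω E ↔
        AKNS.IsPeriodicEigenvalue p q x₀ ω E ∨ AKNS.IsSemiPeriodicEigenvalue p q x₀ ω E) ∧
    ∃ C₁ C₃ : ℝ, 0 < C₁ ∧ 0 < C₃ ∧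
      (∀ E : ℂ, AKNS.IsDoublePeriodicEigenvalue p q x₀ ω₁ E → E ∈ AKNS.strip (AKNS.dir ω₁) C₁) ∧
      (∀ E : ℂ, AKNS.IsDoublePeriodicEigenvalue p q x₀ ω₃ E → E ∈ AKNS.strip (AKNS.dir ω₃) C₃) ∧
      (∃ θ : ℝ, θ ∈ Set.Ioo 0 Real.pi ∧
        Complex.exp (θ * Complex.I) = ω₃ / ω₁ * (‖ω₁ / ω₃‖ : ℂ) ∧
        AKNS.MeetAtAngle (AKNS.stripAxis (AKNS.dir ω₃)) (AKNS.stripAxis (AKNS.dir ω₁)) θ) ∧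
      ∃ R : ℝ, 0 < R ∧ ∀ E : ℂ, R < ‖E‖ →
        E ∉ AKNS.strip (AKNS.dir ω₁) C₁ ∩ AKNS.strip (AKNS.dir ω₃) C₃ := by
  have hpole : ∀ ω ∈ ({ω₁, ω₃} : Set ℂ), AKNS.NoPoleOnLine p q x₀ ω := by simp [h₁, h₃]
  exact theoremt5p3_general ω₁ ω₃ hω p q x₀
    (fun ω hmem => hp.isPeriodicBoundedOnLine hmem fun ζ => (hpole ω hmem ζ).1)
    (fun ω hmem => hq.isPeriodicBoundedOnLine hmem fun ζ => (hpole ω hmem ζ).2)
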